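/- Let $\mathbb D$ be the open unit disk in $\mathbb C$, and let $H^2$ be the Hardy space of the bidisk $\mathbb D^2$, i.e. the Hilbert space of functions $f(z)=\sum_{m,n\ge 0}a_{mn}z_1^mz_2^n$ on $\mathbb D^2$ with $\|f\|^2=\sum_{m,n}|a_{mn}|^2<\infty$. Its reproducing kernel at $\lambda\in\mathbb D^2$ is $$k_\lambda(z)=\frac{1}{(1-\overline{\lambda_1}z_1)(1-\overline{\lambda_2}z_2)}.$$ Let $\mathcal D$ be the linear span of all $k_\lambda$, $\lambda\in\mathbb D^2$. For $f\in H^2$ let $T_f$ be the operator of multiplication by $f$ with domain $\mathcal D$; its adjoint $T_f^*$ is defined on $\mathcal D$ and maps $\mathcal D$ into itself ($T_f^*k_\lambda=\overline{f(\lambda)}k_\lambda$), so $T_fT_f^*$ is defined on $\mathcal D$. An inequality $A\le B$ between operators on $\mathcal D$ means that $\langle (B-A)u,u\rangle\ge 0$ for all $u\in\mathcal D$. Let $\mathcal Q(\mathbb D^2;2,1)$ be the set of triples $(\varphi_1,\varphi_2,\varphi_3)$ of functions in $H^2$ such that $$T_{\varphi_1}T_{\varphi_1}^*+T_{\varphi_2}T_{\varphi_2}^*-T_{\varphi_3}T_{\varphi_3}^*\le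 I \quad\text{on } \mathcal D,$$ and let $\mathcal S(\mathbb D^2;2,1)$ be the set of triples of functions in $H^2$ such that $$0\le T_{\varphi_1}T_{\varphi_1}^*+T_{\varphi_2}T_{\varphi_2}^*-T_{\varphi_3}T_{\varphi_3}^*\le I \quad\text{on } \mathcal D.$$ **Theorem.** Let $\psi=(\psi_1,\psi_2):\mathbb D^2\to\mathbb D^2$ be holomorphic with $\psi(0,0)=(0,0)$, and suppose that $(\psi_1,\psi_2,\psi_1\psi_2)\in\mathcal Q(\mathbb D^2;2,1)$. Then $(\psi_1,\psi_2,\psi_1\psi_2)\in\mathcal S(\mathbb D^2;2,1)$, and for every $z=(z_1,z_2)\in\mathbb D^2$ $$0\le|\psi_1(z)|^2+|\psi_2(z)|^2-|\psi_1(z)\psi_2(z)|^2\le|z_1|^2+|z_2|^2-|z_1z_2|^2 .$$ Moreover, if the equality $$|\psi_1(z)|^2+|\psi_2(z)|^2-|\psi_1(z)\psi_2(z)|^2=|z_1|^2+|z_2|^2-|z_1z_2|^2$$ holds for all $z$ in some non-empty open set $V\subseteq\mathbb D^2$, then there are real numbers $\theta_1,\theta_2$ such that either $\psi(z)=(e^{i\theta_1}z_1,e^{i\theta_2}z_2)$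 for all $z\in\mathbb D^2$, or $\psi(z)=(e^{i\theta_2}z_2,e^{i\theta_1}z_1)$ for all $z\in\mathbb D^2$. -/

import Mathlib

open Set Filter Topology

/-- The open unit bidisk in `ℂ²`. -/
def bidisk : Set (ℂ × ℂ) := Metric.ball (0 : ℂ) 1 ×ˢ Metric.ball (0 : ℂ) 1

/-- The Hardy space `H²` of the bidisk. An element is given by its square-summable family of
Taylor coefficients at the origin; as a function on the bidisk it is the sum of the corresponding
power series, see `Hardy2.apply_eq_tsum`. -/
def Hardy2 : Type := lp (fun _ : ℕ × ℕ => ℂ) 2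

namespace Hardy2

noncomputable section

instance : NormedAddCommGroup Hardy2 :=
  inferInstanceAs (NormedAddCommGroup (lp (fun _ : ℕ × ℕ => ℂ) 2))

instance : InnerProductSpace ℂ Hardy2 :=
  inferInstanceAs (InnerProductSpace ℂ (lp (fun _ : ℕ × ℕ => ℂ) 2))

instance : CompleteSpace Hardy2 :=
  inferInstanceAs (CompleteSpace (lp (fun _ : ℕ × ℕ => ℂ) 2))

/-- An element of the Hardy space as a square-summable family. -/
def toLp (f : Hardy2) : lp (fun _ : ℕ × ℕ => ℂ) 2 := f

/-- The Taylor coefficients of an element of the Hardy space. -/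
def coeff (f : Hardy2) : ℕ × ℕ → ℂ := ⇑(toLp f)

/-- The element of the Hardy space with given Taylor coefficients. -/
def ofCoeff (a : ℕ × ℕ → ℂ) (ha : Memℓp a 2) : Hardy2 :=
  (⟨a, ha⟩ : lp (fun _ : ℕ × ℕ => ℂ) 2)

@[simp] theorem coeff_ofCoeff (a : ℕ × ℕ → ℂ) (ha : Memℓp a 2) : coeff (ofCoeff a ha) = a := rfl

@[simp] theorem coeff_add (f g : Hardy2) : coeff (f + g) = coeff f + coeff g := rfl

@[simp] theorem coeff_smul (c : ℂ) (f : Hardy2) : coeff (c • f) = c • coeff f := rfl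

theorem ext_coeff {f g : Hardy2} (h : coeff f = coeff g) : f = g := lp.ext h

theorem inner_def (f g : Hardy2) : inner ℂ f g = ∑' n, inner ℂ (coeff f n) (coeff g n) := rfl

theorem memℓp_coeff (f : Hardy2) : Memℓp (coeff f) 2 :=
  lp.memℓp (toLp f)

theorem memℓp_two_iff {a : ℕ × ℕ → ℂ} : Memℓp a 2 ↔ Summable fun n => ‖a n‖ ^ 2 := by
  rw [memℓp_gen_iff (by norm_num)]
  simp

theorem norm_sq_eq (f : Hardy2) : ‖f‖ ^ 2 = ∑' n, ‖coeff f n‖ ^ 2 := by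
  have h := lp.norm_rpow_eq_tsum (p := 2) (by norm_num) (toLp f)
  simp only [ENNReal.toReal_ofNat, Real.rpow_ofNat] at h
  exact h

/-- The monomial `z₁ ^ n₁ * z₂ ^ n₂`. -/
def monom (z : ℂ × ℂ) (n : ℕ × ℕ) : ℂ := z.1 ^ n.1 * z.2 ^ n.2

theorem summable_norm_monom {z : ℂ × ℂ} (hz : z ∈ bidisk) : Summable fun n => ‖monom z n‖ := by
  have h1 : ‖z.1‖ < 1 := by simpa using hz.1
  have h2 : ‖z.2‖ < 1 := by simpa using hz.2
  have := (summable_geometric_of_lt_one (norm_nonneg _) h1).mul_of_nonneg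
    (summable_geometric_of_lt_one (norm_nonneg _) h2) (fun _ => by positivity)
    (fun _ => by positivity)
  simpa [monom] using this

theorem memℓp_star_monom {z : ℂ × ℂ} (hz : z ∈ bidisk) :
    Memℓp (fun n => star (monom z n)) 2 := by
  rw [memℓp_two_iff]
  have h1 : ‖z.1‖ < 1 := by simpa using hz.1
  have h2 : ‖z.2‖ < 1 := by simpa using hz.2
  refine Summable.of_nonneg_of_le (fun _ => by positivity) (fun n => ?_) (summable_norm_monom hz)
  rw [norm_star]
  have : ‖monom z n‖ ≤ 1 := by
    rw [monom, norm_mul, norm_pow, norm_pow]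
    exact mul_le_one₀ (pow_le_one₀ (norm_nonneg _) h1.le) (by positivity)
      (pow_le_one₀ (norm_nonneg _) h2.le)
  nlinarith [norm_nonneg (monom z n)]

/-- The coefficients of the reproducing kernel at `z`. -/
def kerVec (z : bidisk) : Hardy2 := ofCoeff (fun n => star (monom z n)) (memℓp_star_monom z.2)

theorem inner_kerVec (z : bidisk) (f : Hardy2) :
    inner ℂ (kerVec z) f = ∑' n, coeff f n * monom z n := by
  simp [inner_def, kerVec, RCLike.inner_apply]

theorem summable_eval (f : Hardy2) (z : bidisk) : Summable fun n => coeff f n * monom z n := by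
  have h := lp.summable_inner (𝕜 := ℂ) (toLp (kerVec z)) (toLp f)
  change Summable fun n => inner ℂ (coeff (kerVec z) n) (coeff f n) at h
  simpa [kerVec, RCLike.inner_apply] using h

/-- The inclusion of the Hardy space into the functions on the bidisk: summation of the
power series. -/
def toFunCLM : Hardy2 →L[ℂ] (bidisk → ℂ) where
  toFun f z := ∑' n : ℕ × ℕ, coeff f n * (z.1.1 ^ n.1 * z.1.2 ^ n.2)
  map_add' f g := by
    funext z
    have := inner_add_right (𝕜 := ℂ) (kerVec z) f g
    simp only [inner_kerVec] at this
    exact this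
  map_smul' c f := by
    funext z
    have := inner_smul_right (𝕜 := ℂ) (kerVec z) f c
    simp only [inner_kerVec] at this
    exact this
  cont := by
    refine continuous_pi fun z => ?_
    have : Continuous fun f : Hardy2 => inner ℂ (kerVec z) f := by fun_prop
    simp only [inner_kerVec] at this
    exact this

theorem eq_zero_of_hasSum_pow {b : ℕ → ℂ}
    (h : ∀ z : ℂ, ‖z‖ < 1 → HasSum (fun n => b n * z ^ n) 0) : b = 0 := by
  have h1 : HasFPowerSeriesAt (fun _ : ℂ => (0 : ℂ))
      (FormalMultilinearSeries.ofScalars ℂ b) 0 := by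
    rw [hasFPowerSeriesAt_iff]
    filter_upwards [Metric.ball_mem_nhds (0 : ℂ) one_pos] with z hz
    have := h z (by simpa using hz)
    simpa [FormalMultilinearSeries.coeff_ofScalars, mul_comm] using this
  have h2 := h1.eq_zero
  funext n
  have h3 := FormalMultilinearSeries.coeff_ofScalars (𝕜 := ℂ) (p := b) (n := n)
  rw [h2] at h3
  rw [← h3]
  rfl

theorem toFunCLM_injective : Function.Injective toFunCLM := by
  rw [injective_iff_map_eq_zero]
  intro f hf
  have h0 : ∀ z : bidisk, HasSum (fun n => coeff f n * monom z n) 0 := fun z => by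
    have h := (summable_eval f z).hasSum
    have h' : ∑' n, coeff f n * monom z n = 0 := congrFun hf z
    rwa [h'] at h
  have key : ∀ w : ℂ, ‖w‖ < 1 → ∀ m, HasSum (fun n => coeff f (m, n) * w ^ n) 0 := by
    intro w hw
    have hs : ∀ z : ℂ, ‖z‖ < 1 → ∀ m, Summable fun n => coeff f (m, n) * (z ^ m * w ^ n) :=
      fun z hz m => (h0 ⟨(z, w), by simpa [bidisk] using ⟨hz, hw⟩⟩).summable.prod_factor m
    have hs' : ∀ m, Summable fun n => coeff f (m, n) * w ^ n := fun m => by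
      have h := (hs (1 / 2) (by norm_num) m).mul_left ((2 : ℂ) ^ m)
      refine h.congr fun n => ?_
      have : (2 : ℂ) ^ m * (1 / 2) ^ m = 1 := by rw [← mul_pow]; norm_num
      linear_combination (coeff f (m, n) * w ^ n) * this
    have hb : (fun m => ∑' n, coeff f (m, n) * w ^ n) = 0 := by
      refine eq_zero_of_hasSum_pow fun z hz => ?_
      have h := (h0 ⟨(z, w), by simpa [bidisk] using ⟨hz, hw⟩⟩).prod_fiberwise
        (fun m => (hs z hz m).hasSum)
      convert h using 2 with m
      rw [← tsum_mul_right]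
      exact tsum_congr fun n => by ring
    intro m
    have h := (hs' m).hasSum
    rwa [show ∑' n, coeff f (m, n) * w ^ n = 0 from congrFun hb m] at h
  refine ext_coeff (funext fun n => ?_)
  exact congrFun (eq_zero_of_hasSum_pow fun w hw => key w hw n.1) n.2

instance : RKHS ℂ Hardy2 bidisk ℂ where
  coeCLM := toFunCLM
  coeCLM_injective := toFunCLM_injective

theorem apply_eq_tsum (f : Hardy2) (z : bidisk) :
    f z = ∑' n : ℕ × ℕ, coeff f n * (z.1.1 ^ n.1 * z.1.2 ^ n.2) := rfl

/-- The reproducing kernel of the Hardy space at `l`. -/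
def ker (l : bidisk) : Hardy2 := RKHS.kerFun Hardy2 l 1

theorem inner_ker (l : bidisk) (f : Hardy2) : inner ℂ (ker l) f = f l := by
  simp [ker]

theorem ker_eq_kerVec (l : bidisk) : ker l = kerVec l := by
  refine ext_inner_right ℂ fun f => ?_
  rw [inner_ker, inner_kerVec]
  rfl

theorem ker_apply (l z : bidisk) :
    ker l z = 1 / ((1 - star l.1.1 * z.1.1) * (1 - star l.1.2 * z.1.2)) := by
  have h1 : ‖star l.1.1 * z.1.1‖ < 1 := by
    rw [norm_mul, norm_star]
    exact mul_lt_one_of_nonneg_of_lt_one_left (norm_nonneg _) (by simpa using l.2.1)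
      (mem_ball_zero_iff.mp z.2.1).le
  have h2 : ‖star l.1.2 * z.1.2‖ < 1 := by
    rw [norm_mul, norm_star]
    exact mul_lt_one_of_nonneg_of_lt_one_left (norm_nonneg _) (by simpa using l.2.2)
      (mem_ball_zero_iff.mp z.2.2).le
  have h := (hasSum_geometric_of_norm_lt_one h1).mul (hasSum_geometric_of_norm_lt_one h2)
    (summable_mul_of_summable_norm (summable_norm_geometric_of_norm_lt_one h1)
      (summable_norm_geometric_of_norm_lt_one h2))
  rw [one_div, mul_inv, ker_eq_kerVec, apply_eq_tsum, ← h.tsum_eq]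
  refine tsum_congr fun n => ?_
  simp only [kerVec, coeff_ofCoeff, monom, star_mul', star_pow, mul_pow]
  ring

/-- The linear span of all reproducing kernels. -/
def kerSpan : Submodule ℂ Hardy2 := Submodule.span ℂ (range ker)

theorem ker_mem_kerSpan (l : bidisk) : ker l ∈ kerSpan := Submodule.subset_span ⟨l, rfl⟩

theorem dense_kerSpan : Dense (kerSpan : Set Hardy2) := by
  rw [Submodule.dense_iff_topologicalClosure_eq_top, eq_top_iff,
    ← RKHS.kerFun_dense (H := Hardy2)]
  refine Submodule.topologicalClosure_mono (Submodule.span_le.mpr ?_)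
  rintro _ ⟨l, v, rfl⟩
  have : RKHS.kerFun Hardy2 l v = v • ker l := by
    rw [ker, ← map_smul, smul_eq_mul, mul_one]
  rw [this]
  exact kerSpan.smul_mem v (ker_mem_kerSpan l)

theorem summable_norm_sq_coeff (f : Hardy2) : Summable fun n => ‖coeff f n‖ ^ 2 :=
  memℓp_two_iff.mp (memℓp_coeff f)

theorem norm_sq_extend (s : ℕ × ℕ → ℕ × ℕ) (a : ℕ × ℕ → ℂ) :
    (fun n => ‖Function.extend s a 0 n‖ ^ 2) = Function.extend s (fun n => ‖a n‖ ^ 2) 0 := by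
  funext n
  rw [Function.apply_extend (fun x : ℂ => ‖x‖ ^ 2)]
  congr 1
  funext m
  simp

/-- Shifting the coefficients along an injection. -/
def shift (s : ℕ × ℕ → ℕ × ℕ) (hs : Function.Injective s) : Hardy2 →L[ℂ] Hardy2 :=
  LinearMap.mkContinuous
    { toFun := fun f => ofCoeff (Function.extend s (coeff f) 0) (by
        rw [memℓp_two_iff, norm_sq_extend]
        exact ((hasSum_extend_zero hs).mpr (summable_norm_sq_coeff f).hasSum).summable)
      map_add' := fun f g => ext_coeff <| by
        exact (Function.ExtendByZero.linearMap ℂ s).map_add (coeff f) (coeff g)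
      map_smul' := fun c f => ext_coeff <| by
        exact (Function.ExtendByZero.linearMap ℂ s).map_smul c (coeff f) }
    1 (fun f => by
      rw [one_mul, ← sq_le_sq₀ (norm_nonneg _) (norm_nonneg _), norm_sq_eq, norm_sq_eq]
      refine le_of_eq ?_
      change ∑' n, ‖Function.extend s (coeff f) 0 n‖ ^ 2 = _
      rw [norm_sq_extend]
      exact ((hasSum_extend_zero hs).mpr (summable_norm_sq_coeff f).hasSum).tsum_eq)

theorem coeff_shift (s : ℕ × ℕ → ℕ × ℕ) (hs : Function.Injective s) (f : Hardy2) :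
    coeff (shift s hs f) = Function.extend s (coeff f) 0 := rfl

theorem norm_shift_le (s : ℕ × ℕ → ℕ × ℕ) (hs : Function.Injective s) : ‖shift s hs‖ ≤ 1 :=
  LinearMap.mkContinuous_norm_le _ zero_le_one _

theorem shift_apply (s : ℕ × ℕ → ℕ × ℕ) (hs : Function.Injective s) (f : Hardy2) (z : bidisk)
    (w : ℂ) (hw : ∀ n, monom z (s n) = w * monom z n) : shift s hs f z = w * f z := by
  have h := (hasSum_extend_zero hs).mpr ((summable_eval f z).hasSum.mul_left w)
  rw [apply_eq_tsum, coeff_shift]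
  refine Eq.trans (tsum_congr fun n => ?_) h.tsum_eq
  by_cases hn : ∃ m, s m = n
  · obtain ⟨m, rfl⟩ := hn
    rw [hs.extend_apply, hs.extend_apply]
    have := hw m
    rw [monom] at this
    rw [this]
    ring
  · rw [Function.extend_apply' _ _ _ hn, Function.extend_apply' _ _ _ hn]
    simp

theorem exists_one_sub_mul_eq (S : Hardy2 →L[ℂ] Hardy2) (hS : ‖S‖ ≤ 1) (w : bidisk → ℂ)
    (hw : ∀ f : Hardy2, ∀ z, S f z = w z * f z) (c : ℂ) (hc : ‖c‖ < 1) (f : Hardy2) :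
    ∃ g : Hardy2, ∀ z, (1 - c * w z) * g z = f z := by
  have hn : ‖c • S‖ < 1 := by
    rw [norm_smul]
    exact mul_lt_one_of_nonneg_of_lt_one_left (norm_nonneg _) hc hS
  obtain ⟨u, hu⟩ := isUnit_one_sub_of_norm_lt_one hn
  refine ⟨(↑u⁻¹ : Hardy2 →L[ℂ] Hardy2) f, fun z => ?_⟩
  set g := (↑u⁻¹ : Hardy2 →L[ℂ] Hardy2) f with hg
  have h1 : ((u : Hardy2 →L[ℂ] Hardy2) * (↑u⁻¹ : Hardy2 →L[ℂ] Hardy2)) f = f := by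
    rw [Units.mul_inv]
    rfl
  have h2 : g - c • S g = f := by
    rw [hu] at h1
    exact h1
  have h3 := congrArg (fun k : Hardy2 => k z) h2
  simp only [RKHS.coe_sub, RKHS.coe_smul, Pi.sub_apply, Pi.smul_apply, smul_eq_mul, hw] at h3
  rw [← h3]
  ring

theorem exists_mul_ker (f : Hardy2) (l : bidisk) : ∃ g : Hardy2, ∀ z, g z = f z * ker l z := by
  have h1 : ‖star l.1.1‖ < 1 := by rw [norm_star]; exact mem_ball_zero_iff.mp l.2.1
  have h2 : ‖star l.1.2‖ < 1 := by rw [norm_star]; exact mem_ball_zero_iff.mp l.2.2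
  have i1 : Function.Injective fun n : ℕ × ℕ => (n.1 + 1, n.2) := fun a b h => by
    simpa [Prod.ext_iff] using h
  have i2 : Function.Injective fun n : ℕ × ℕ => (n.1, n.2 + 1) := fun a b h => by
    simpa [Prod.ext_iff] using h
  obtain ⟨g, hg⟩ := exists_one_sub_mul_eq (shift _ i1) (norm_shift_le _ i1) (fun z => z.1.1)
    (fun f z => shift_apply _ i1 f z _ fun n => by simp only [monom]; ring) _ h1 f
  obtain ⟨k, hk⟩ := exists_one_sub_mul_eq (shift _ i2) (norm_shift_le _ i2) (fun z => z.1.2)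
    (fun f z => shift_apply _ i2 f z _ fun n => by simp only [monom]; ring) _ h2 g
  refine ⟨k, fun z => ?_⟩
  have n1 : 1 - star l.1.1 * z.1.1 ≠ 0 := fun h => by
    have h3 : ‖star l.1.1 * z.1.1‖ < 1 := by
      rw [norm_mul]
      exact mul_lt_one_of_nonneg_of_lt_one_left (norm_nonneg _) h1
        (mem_ball_zero_iff.mp z.2.1).le
    rw [← sub_eq_zero.mp h, norm_one] at h3
    exact lt_irrefl _ h3
  have n2 : 1 - star l.1.2 * z.1.2 ≠ 0 := fun h => by
    have h3 : ‖star l.1.2 * z.1.2‖ < 1 := by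
      rw [norm_mul]
      exact mul_lt_one_of_nonneg_of_lt_one_left (norm_nonneg _) h2
        (mem_ball_zero_iff.mp z.2.2).le
    rw [← sub_eq_zero.mp h, norm_one] at h3
    exact lt_irrefl _ h3
  rw [ker_apply, ← hg z, ← hk z]
  field_simp

theorem exists_mul (f : Hardy2) (u : kerSpan) :
    ∃ g : Hardy2, ∀ z, g z = f z * (u : Hardy2) z := by
  obtain ⟨u, hu⟩ := u
  induction hu using Submodule.span_induction with
  | mem x h =>
    obtain ⟨l, rfl⟩ := h
    exact exists_mul_ker f l
  | zero => exact ⟨0, fun z => by simp⟩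
  | add x y _ _ hx hy =>
    obtain ⟨g, hg⟩ := hx
    obtain ⟨k, hk⟩ := hy
    exact ⟨g + k, fun z => by simp [hg, hk, mul_add]⟩
  | smul c x _ hx =>
    obtain ⟨g, hg⟩ := hx
    exact ⟨c • g, fun z => by simp [hg, mul_left_comm]⟩

/-- The multiplication operator `T_f`, `f ∈ H²`, with domain the span of the reproducing
kernels; see `toeplitz_apply`. -/
def toeplitz (f : Hardy2) : Hardy2 →ₗ.[ℂ] Hardy2 where
  domain := kerSpan
  toFun :=
    { toFun := fun u => (exists_mul f u).choose
      map_add' := fun u v => RKHS.ext fun z => by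
        rw [(exists_mul f (u + v)).choose_spec, RKHS.coe_add, Pi.add_apply,
          (exists_mul f u).choose_spec, (exists_mul f v).choose_spec, Submodule.coe_add,
          RKHS.coe_add, Pi.add_apply, mul_add]
      map_smul' := fun c u => RKHS.ext fun z => by
        rw [(exists_mul f (c • u)).choose_spec, RingHom.id_apply, RKHS.coe_smul, Pi.smul_apply,
          (exists_mul f u).choose_spec, Submodule.coe_smul, RKHS.coe_smul, Pi.smul_apply,
          smul_eq_mul, smul_eq_mul, mul_left_comm] }

theorem toeplitz_apply (f : Hardy2) (u : kerSpan) (z : bidisk) :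
    toeplitz f u z = f z * (u : Hardy2) z :=
  (exists_mul f u).choose_spec z

theorem inner_ker_toeplitz (f : Hardy2) (l : bidisk) (u : kerSpan) :
    inner ℂ (star (f l) • ker l) (u : Hardy2) = inner ℂ (ker l) (toeplitz f u) := by
  rw [inner_smul_left, inner_ker, inner_ker, toeplitz_apply]
  simp

theorem ker_mem_adjoint_domain (f : Hardy2) (l : bidisk) : ker l ∈ (toeplitz f).adjoint.domain :=
  LinearPMap.mem_adjoint_domain_of_exists _ ⟨star (f l) • ker l, inner_ker_toeplitz f l⟩

theorem adjoint_toeplitz_ker (f : Hardy2) (l : bidisk) :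
    (toeplitz f).adjoint ⟨ker l, ker_mem_adjoint_domain f l⟩ = star (f l) • ker l :=
  LinearPMap.adjoint_apply_eq dense_kerSpan _ (inner_ker_toeplitz f l)

theorem kerSpan_le_adjoint_domain (f : Hardy2) : kerSpan ≤ (toeplitz f).adjoint.domain :=
  Submodule.span_le.mpr (by rintro _ ⟨l, rfl⟩; exact ker_mem_adjoint_domain f l)

/-- The restriction of the adjoint of `T_f` to the span of the reproducing kernels. -/
def toeplitzAdj (f : Hardy2) : kerSpan →ₗ[ℂ] Hardy2 :=
  (toeplitz f).adjoint.toFun ∘ₗ Submodule.inclusion (kerSpan_le_adjoint_domain f)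

theorem toeplitzAdj_ker (f : Hardy2) (l : bidisk) :
    toeplitzAdj f ⟨ker l, ker_mem_kerSpan l⟩ = star (f l) • ker l :=
  adjoint_toeplitz_ker f l

theorem toeplitzAdj_mem (f : Hardy2) (u : kerSpan) : toeplitzAdj f u ∈ kerSpan := by
  obtain ⟨u, hu⟩ := u
  induction hu using Submodule.span_induction with
  | mem x h =>
    obtain ⟨l, rfl⟩ := h
    have h := toeplitzAdj_ker f l
    change toeplitzAdj f ⟨ker l, _⟩ ∈ kerSpan
    rw [h]
    exact kerSpan.smul_mem _ (ker_mem_kerSpan l)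
  | zero =>
    have h : toeplitzAdj f 0 ∈ kerSpan := by rw [map_zero]; exact kerSpan.zero_mem
    exact h
  | add x y hx hy ihx ihy =>
    have h := (toeplitzAdj f).map_add ⟨x, hx⟩ ⟨y, hy⟩
    change toeplitzAdj f (⟨x, hx⟩ + ⟨y, hy⟩) ∈ kerSpan
    rw [h]
    exact kerSpan.add_mem ihx ihy
  | smul c x hx ih =>
    have h := (toeplitzAdj f).map_smul c ⟨x, hx⟩
    change toeplitzAdj f (c • ⟨x, hx⟩) ∈ kerSpan
    rw [h]
    exact kerSpan.smul_mem _ ih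

/-- The operator `T_f T_f^*`, defined on the span of the reproducing kernels. -/
def toeplitzMulAdj (f : Hardy2) : kerSpan →ₗ[ℂ] Hardy2 :=
  (toeplitz f).toFun ∘ₗ (toeplitzAdj f).codRestrict kerSpan (toeplitzAdj_mem f)

/-- The identity operator on the span of the reproducing kernels. -/
def idOp : kerSpan →ₗ[ℂ] Hardy2 := kerSpan.subtype

open scoped ComplexOrder in
/-- The operator inequality `A ≤ B` on the span of the reproducing kernels: the number
`⟨(B - A) u, u⟩` is real and nonnegative for every `u` in that span. -/
def OpLE (A B : kerSpan →ₗ[ℂ] Hardy2) : Prop :=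
  ∀ u : kerSpan, 0 ≤ inner ℂ (u : Hardy2) ((B - A) u)

/-- The operator `T_{f₁} T_{f₁}^* + T_{f₂} T_{f₂}^* - T_{f₃} T_{f₃}^*`. -/
def defectOp (f₁ f₂ f₃ : Hardy2) : kerSpan →ₗ[ℂ] Hardy2 :=
  toeplitzMulAdj f₁ + toeplitzMulAdj f₂ - toeplitzMulAdj f₃

/-- The function `φ` restricts to the element `f` of the Hardy space on the bidisk. -/
def Represents (f : Hardy2) (φ : ℂ × ℂ → ℂ) : Prop := ∀ z : bidisk, f z = φ z

end

end Hardy2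

open Hardy2

/-- The class `𝒬(𝔻²; 2, 1)`: triples of functions in `H²` with
`T_{φ₁} T_{φ₁}^* + T_{φ₂} T_{φ₂}^* - T_{φ₃} T_{φ₃}^* ≤ I`. -/
def ClassQ (φ₁ φ₂ φ₃ : ℂ × ℂ → ℂ) : Prop :=
  ∃ f₁ f₂ f₃ : Hardy2, Represents f₁ φ₁ ∧ Represents f₂ φ₂ ∧ Represents f₃ φ₃ ∧
    OpLE (defectOp f₁ f₂ f₃) idOp

/-- The class `𝒮(𝔻²; 2, 1)`: triples of functions in `H²` with
`0 ≤ T_{φ₁} T_{φ₁}^* + T_{φ₂} T_{φ₂}^* - T_{φ₃} T_{φ₃}^* ≤ I`. -/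
def ClassS (φ₁ φ₂ φ₃ : ℂ × ℂ → ℂ) : Prop :=
  ∃ f₁ f₂ f₃ : Hardy2, Represents f₁ φ₁ ∧ Represents f₂ φ₂ ∧ Represents f₃ φ₃ ∧
    OpLE 0 (defectOp f₁ f₂ f₃) ∧ OpLE (defectOp f₁ f₂ f₃) idOp

open scoped ComplexOrder ComplexConjugate

/-- A kernel is positive semidefinite if all its Gram forms are nonnegative. -/
def IsPSDKernel {X : Type*} (K : X → X → ℂ) : Prop :=
  ∀ (n : ℕ) (x : Fin n → X) (c : Fin n → ℂ),
    0 ≤ ∑ i, ∑ j, conj (c i) * c j * K (x i) (x j)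

namespace IsPSDKernel

variable {X : Type*} {K L : X → X → ℂ}

theorem add (hK : IsPSDKernel K) (hL : IsPSDKernel L) :
    IsPSDKernel fun x y => K x y + L x y := fun n x c => by
  have := add_nonneg (hK n x c) (hL n x c)
  simpa only [mul_add, Finset.sum_add_distrib] using this

theorem conj_mul (hK : IsPSDKernel K) (g : X → ℂ) :
    IsPSDKernel fun x y => g x * conj (g y) * K x y := fun n x c => by
  have := hK n x fun i => c i * conj (g (x i))
  refine this.trans_eq (Finset.sum_congr rfl fun i _ => Finset.sum_congr rfl fun j _ => ?_)
  simp only [map_mul, Complex.conj_conj]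
  ring

theorem conj_pow_mul (hK : IsPSDKernel K) (g : X → ℂ) (m : ℕ) :
    IsPSDKernel fun x y => (g x * conj (g y)) ^ m * K x y := by
  simpa [mul_pow] using hK.conj_mul fun x => g x ^ m

theorem div_one_sub (hK : IsPSDKernel K) {g : X → ℂ} (hg : ∀ x, ‖g x‖ < 1) :
    IsPSDKernel fun x y => (1 - g x * conj (g y))⁻¹ * K x y := fun n x c => by
  have h : HasSum (fun m : ℕ => ∑ i, ∑ j, conj (c i) * c j *
      ((g (x i) * conj (g (x j))) ^ m * K (x i) (x j)))
      (∑ i, ∑ j, conj (c i) * c j * ((1 - g (x i) * conj (g (x j)))⁻¹ * K (x i) (x j))) := by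
    refine hasSum_sum fun i _ => hasSum_sum fun j _ => ?_
    have hlt : ‖g (x i) * conj (g (x j))‖ < 1 := by
      rw [norm_mul, RCLike.norm_conj]
      exact mul_lt_one_of_nonneg_of_lt_one_left (norm_nonneg _) (hg _) (hg _).le
    exact ((hasSum_geometric_of_norm_lt_one hlt).mul_right (K (x i) (x j))).mul_left
      (conj (c i) * c j)
  exact h.nonneg fun m => hK.conj_pow_mul g m n x c

/-- A positive semidefinite kernel normalized at a base point is at least one on the diagonal. -/
theorem one_le_diag (hK : IsPSDKernel K) {o : X} (h1 : ∀ x, K x o = 1) (h2 : ∀ x, K o x = 1)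
    (x : X) : 1 ≤ K x x := by
  have := hK 2 ![o, x] ![-1, 1]
  simp [Fin.sum_univ_two, h1, h2] at this
  exact this

/-- If a normalized positive semidefinite kernel equals one at a diagonal point, it equals one on
the whole row. -/
theorem eq_one_of_diag_eq_one (hK : IsPSDKernel K) {o : X} (h1 : ∀ x, K x o = 1)
    (h2 : ∀ x, K o x = 1) {x : X} (hx : K x x = 1) (y : X) : K x y = 1 := by
  have key : ∀ s : ℂ, 0 ≤ s * (K x y - 1) + conj s * (K y x - 1) + conj s * s * (K y y - 1) := by
    intro s
    have := hK 3 ![o, x, y] ![-1 - s, 1, s]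
    simp [Fin.sum_univ_three, h1, h2, hx] at this
    refine this.trans_eq ?_
    ring
  obtain ⟨d, hd, hd'⟩ : ∃ d : ℝ, 0 ≤ d ∧ K y y - 1 = d := by
    have h := sub_nonneg.mpr (hK.one_le_diag h1 h2 y)
    rw [Complex.nonneg_iff] at h
    exact ⟨(K y y - 1).re, h.1, Complex.ext rfl h.2.symm⟩
  rw [hd'] at key
  set p := K x y - 1 with hp
  set q := K y x - 1
  have hq : q = conj p := by
    have e1 := (Complex.nonneg_iff.mp (key 1)).2
    have e2 := (Complex.nonneg_iff.mp (key Complex.I)).2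
    simp at e1 e2
    refine Complex.ext ?_ ?_ <;> simp <;> linarith
  rw [hq] at key
  have h3 : ∀ t : ℝ, 0 ≤ t → 2 * t * ‖p‖ ^ 2 ≤ t ^ 2 * ‖p‖ ^ 2 * d := by
    intro t ht
    have e := (Complex.nonneg_iff.mp (key (-t * conj p))).1
    have e' : -(t : ℂ) * conj p * p + conj (-(t : ℂ) * conj p) * conj p
        + conj (-(t : ℂ) * conj p) * (-t * conj p) * d
        = ((-(2 * t * ‖p‖ ^ 2) + t ^ 2 * ‖p‖ ^ 2 * d : ℝ) : ℂ) := by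
      push_cast
      rw [← Complex.mul_conj']
      simp only [map_mul, map_neg, Complex.conj_conj, Complex.conj_ofReal]
      ring
    rw [e', Complex.ofReal_re] at e
    linarith
  have h4 := h3 (1 / (d + 1)) (by positivity)
  have h5 : ‖p‖ ^ 2 = 0 := by
    have : 0 < d + 1 := by positivity
    field_simp at h4
    nlinarith [sq_nonneg ‖p‖]
  have : p = 0 := by simpa using h5
  exact sub_eq_zero.mp this

end IsPSDKernel

namespace Hardy2

theorem inner_ker_toeplitzMulAdj (f : Hardy2) (l m : bidisk) :
    inner ℂ (ker l) (toeplitzMulAdj f ⟨ker m, ker_mem_kerSpan m⟩) =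
      f l * conj (f m) * ker m l := by
  rw [inner_ker]
  have h : (⟨toeplitzAdj f ⟨ker m, ker_mem_kerSpan m⟩, toeplitzAdj_mem f _⟩ : kerSpan) =
      star (f m) • ⟨ker m, ker_mem_kerSpan m⟩ := Subtype.ext (toeplitzAdj_ker f m)
  refine (congrArg (fun v : kerSpan => toeplitz f v l) h).trans ?_
  simp [toeplitz_apply, mul_assoc]

theorem inner_sum_ker (A : kerSpan →ₗ[ℂ] Hardy2) (n : ℕ) (l : Fin n → bidisk) (c : Fin n → ℂ) :
    inner ℂ ((∑ i, c i • (⟨ker (l i), ker_mem_kerSpan _⟩ : kerSpan) : kerSpan) : Hardy2)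
        (A (∑ i, c i • (⟨ker (l i), ker_mem_kerSpan _⟩ : kerSpan))) =
      ∑ i, ∑ j, conj (c i) * c j *
        inner ℂ (ker (l i)) (A ⟨ker (l j), ker_mem_kerSpan _⟩) := by
  simp only [map_sum, map_smul, Submodule.coe_sum, Submodule.coe_smul, sum_inner, inner_sum,
    inner_smul_left, inner_smul_right]
  rw [Finset.sum_comm]
  simp only [Finset.mul_sum]
  exact Finset.sum_congr rfl fun i _ => Finset.sum_congr rfl fun j _ => by ring

theorem opLE_iff_isPSDKernel (A B : kerSpan →ₗ[ℂ] Hardy2) :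
    OpLE A B ↔ IsPSDKernel fun l m : bidisk =>
      inner ℂ (ker l) ((B - A) ⟨ker m, ker_mem_kerSpan m⟩) := by
  constructor
  · intro h n l c
    rw [← inner_sum_ker (B - A)]
    exact h _
  · rintro h ⟨u, hu⟩
    obtain ⟨n, c, g, rfl⟩ := (Submodule.mem_span_set' (s := range ker)).mp hu
    choose l hl using fun i => (g i).2
    have e : (⟨∑ i, c i • (g i : Hardy2), hu⟩ : kerSpan) =
        ∑ i, c i • (⟨ker (l i), ker_mem_kerSpan _⟩ : kerSpan) :=
      Subtype.ext (by simp [hl])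
    rw [e, inner_sum_ker]
    exact h n l c

theorem inner_ker_defectOp (f₁ f₂ f₃ : Hardy2) (l m : bidisk) :
    inner ℂ (ker l) (defectOp f₁ f₂ f₃ ⟨ker m, ker_mem_kerSpan m⟩) =
      (f₁ l * conj (f₁ m) + f₂ l * conj (f₂ m) - f₃ l * conj (f₃ m)) * ker m l := by
  simp only [defectOp, LinearMap.add_apply, LinearMap.sub_apply, inner_add_right, inner_sub_right,
    inner_ker_toeplitzMulAdj]
  ring

theorem opLE_defectOp_idOp_iff {f₁ f₂ f₃ : Hardy2} (h : ∀ z, f₃ z = f₁ z * f₂ z) :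
    OpLE (defectOp f₁ f₂ f₃) idOp ↔ IsPSDKernel fun l m : bidisk =>
      (1 - f₁ l * conj (f₁ m)) * (1 - f₂ l * conj (f₂ m)) * ker m l := by
  rw [opLE_iff_isPSDKernel]
  refine iff_of_eq (congrArg _ (funext fun l => funext fun m => ?_))
  rw [LinearMap.sub_apply, inner_sub_right, inner_ker_defectOp, h, h]
  change inner ℂ (ker l) (ker m) - _ = _
  rw [inner_ker, map_mul]
  ring

theorem opLE_zero_defectOp_iff {f₁ f₂ f₃ : Hardy2} (h : ∀ z, f₃ z = f₁ z * f₂ z) :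
    OpLE 0 (defectOp f₁ f₂ f₃) ↔ IsPSDKernel fun l m : bidisk =>
      (f₁ l * conj (f₁ m) + f₂ l * conj (f₂ m) - f₁ l * f₂ l * conj (f₁ m * f₂ m)) *
        ker m l := by
  rw [opLE_iff_isPSDKernel]
  refine iff_of_eq (congrArg _ (funext fun l => funext fun m => ?_))
  rw [sub_zero, inner_ker_defectOp, h, h]

theorem one_sub_mul_conj_ne_zero {a b : ℂ} (ha : ‖a‖ < 1) (hb : ‖b‖ < 1) :
    1 - a * conj b ≠ 0 := fun h => by
  have h3 : ‖a * conj b‖ < 1 := by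
    rw [norm_mul, RCLike.norm_conj]
    exact mul_lt_one_of_nonneg_of_lt_one_left (norm_nonneg _) ha hb.le
  rw [← sub_eq_zero.mp h, norm_one] at h3
  exact lt_irrefl _ h3

/-- For contractive symbols, the upper bound of the defect operator implies its positivity. -/
theorem opLE_zero_defectOp_of_opLE_idOp {f₁ f₂ f₃ : Hardy2} (h : ∀ z, f₃ z = f₁ z * f₂ z)
    (h₁ : ∀ z, ‖f₁ z‖ < 1) (h₂ : ∀ z, ‖f₂ z‖ < 1) (hQ : OpLE (defectOp f₁ f₂ f₃) idOp) :
    OpLE 0 (defectOp f₁ f₂ f₃) := by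
  rw [opLE_defectOp_idOp_iff h] at hQ
  rw [opLE_zero_defectOp_iff h]
  have hP := hQ.div_one_sub h₁
  have hk := hP.div_one_sub h₂
  have := (hP.conj_mul fun z => f₁ z).add (hk.conj_mul fun z => f₂ z)
  convert this using 3 with l m
  have n1 := one_sub_mul_conj_ne_zero (h₁ l) (h₁ m)
  have n2 := one_sub_mul_conj_ne_zero (h₂ l) (h₂ m)
  rw [map_mul]
  field_simp
  ring

end Hardy2

theorem mem_bidisk {z : ℂ × ℂ} : z ∈ bidisk ↔ ‖z.1‖ < 1 ∧ ‖z.2‖ < 1 := by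
  simp [bidisk]

theorem isOpen_bidisk : IsOpen bidisk := Metric.isOpen_ball.prod Metric.isOpen_ball

theorem convex_bidisk : Convex ℝ bidisk := (convex_ball _ _).prod (convex_ball _ _)

/-- The identity theorem on the bidisk. -/
theorem eqOn_bidisk_of_eqOn_open {g : ℂ × ℂ → ℂ} (hg : DifferentiableOn ℂ g bidisk)
    {V : Set (ℂ × ℂ)} (hV : IsOpen V) (hne : V.Nonempty) (hVs : V ⊆ bidisk)
    (h : ∀ z ∈ V, g z = 0) : ∀ z ∈ bidisk, g z = 0 := by
  obtain ⟨z₀, hz₀⟩ := hne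
  intro z hz
  let γ : ℂ → ℂ × ℂ := fun t => z₀ + t • (z - z₀)
  have hγ : Differentiable ℂ γ := by fun_prop
  have hU : IsOpen (γ ⁻¹' bidisk) := isOpen_bidisk.preimage hγ.continuous
  have hc : Convex ℝ (γ ⁻¹' bidisk) := by
    intro s hs t ht a b ha hb hab
    have e : γ (a • s + b • t) = a • γ s + b • γ t := by
      have hab' : (a : ℂ) + b = 1 := by exact_mod_cast hab
      refine Prod.ext ?_ ?_ <;> simp [γ]
      · linear_combination (-z₀.1) * hab'
      · linear_combination (-z₀.2) * hab'
    rw [mem_preimage, e]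
    exact convex_bidisk hs ht ha hb hab
  have hd : DifferentiableOn ℂ (g ∘ γ) (γ ⁻¹' bidisk) :=
    hg.comp hγ.differentiableOn fun _ ht => ht
  have h0 : (0 : ℂ) ∈ γ ⁻¹' bidisk := by simpa [γ] using hVs hz₀
  have h1 : (1 : ℂ) ∈ γ ⁻¹' bidisk := by simpa [γ] using hz
  have hev : (g ∘ γ) =ᶠ[𝓝 0] 0 := by
    have : γ ⁻¹' V ∈ 𝓝 (0 : ℂ) :=
      (hV.preimage hγ.continuous).mem_nhds (by simpa [γ] using hz₀)
    filter_upwards [this] with t ht using h _ ht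
  have := (hd.analyticOnNhd hU).eqOn_zero_of_preconnected_of_eventuallyEq_zero
    hc.isPreconnected h0 hev h1
  simpa [γ] using this

/-- Two functions on the bidisk with the same sesqui-holomorphic kernel as the coordinates are,
together with their product, linear combinations of `z₁`, `z₂` and `z₁ z₂`. -/
theorem exists_linear_of_kernel_eq {p q : ℂ × ℂ → ℂ}
    (h : ∀ z ∈ bidisk, ∀ w ∈ bidisk, (1 - p z * conj (p w)) * (1 - q z * conj (q w)) =
      (1 - z.1 * conj w.1) * (1 - z.2 * conj w.2)) :
    ∃ L : Matrix (Fin 3) (Fin 3) ℂ, ∀ z ∈ bidisk,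
      p z = L 0 0 * z.1 + L 0 1 * z.2 + L 0 2 * (z.1 * z.2) ∧
      q z = L 1 0 * z.1 + L 1 1 * z.2 + L 1 2 * (z.1 * z.2) ∧
      p z * q z = L 2 0 * z.1 + L 2 1 * z.2 + L 2 2 * (z.1 * z.2) := by
  let w : Fin 3 → ℂ × ℂ := ![(1 / 2, 0), (0, 1 / 2), (1 / 2, 1 / 2)]
  have hw : ∀ i, w i ∈ bidisk := by
    intro i
    fin_cases i <;> simp [w, mem_bidisk] <;> norm_num
  let P : ℂ × ℂ → Fin 3 → ℂ := fun z => ![p z, q z, p z * q z]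
  let Z : ℂ × ℂ → Fin 3 → ℂ := fun z => ![z.1, z.2, z.1 * z.2]
  let M : Matrix (Fin 3) (Fin 3) ℂ :=
    Matrix.of fun i => ![conj (p (w i)), conj (q (w i)), -(conj (p (w i)) * conj (q (w i)))]
  let N : Matrix (Fin 3) (Fin 3) ℂ := !![1 / 2, 0, 0; 0, 1 / 2, 0; 1 / 2, 1 / 2, -1 / 4]
  have hMN : ∀ z ∈ bidisk, M.mulVec (P z) = N.mulVec (Z z) := by
    intro z hz
    have e : ∀ i, M.mulVec (P z) i =
        1 - (1 - z.1 * conj (w i).1) * (1 - z.2 * conj (w i).2) := by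
      intro i
      rw [← h z hz _ (hw i)]
      simp [M, P, Matrix.mulVec, dotProduct, Fin.sum_univ_three]
      ring
    funext i
    rw [e]
    fin_cases i <;> simp [N, Z, w, Matrix.mulVec, dotProduct, Fin.sum_univ_three, map_ofNat] <;> ring
  let A : Matrix (Fin 3) (Fin 3) ℂ := Matrix.of fun i j => P (w j) i
  let B : Matrix (Fin 3) (Fin 3) ℂ := Matrix.of fun i j => Z (w j) i
  have hAB : M * A = N * B := by
    ext i j
    exact congrFun (hMN _ (hw j)) i
  have hdet : M.det ≠ 0 := by
    intro h0
    have h1 := congrArg Matrix.det hAB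
    rw [Matrix.det_mul, Matrix.det_mul, h0, zero_mul] at h1
    have h2 : N.det = -1 / 16 := by
      simp [N, Matrix.det_fin_three]
      norm_num
    have h3 : B.det = 1 / 16 := by
      simp [B, Z, w, Matrix.det_fin_three]
      norm_num
    rw [h2, h3] at h1
    norm_num at h1
  refine ⟨M⁻¹ * N, fun z hz => ?_⟩
  have hP : P z = (M⁻¹ * N).mulVec (Z z) := by
    rw [← Matrix.mulVec_mulVec, ← hMN z hz, Matrix.mulVec_mulVec,
      Matrix.nonsing_inv_mul _ (isUnit_iff_ne_zero.mpr hdet), Matrix.one_mulVec]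
  have h' : ∀ i, P z i = (M⁻¹ * N) i 0 * z.1 + (M⁻¹ * N) i 1 * z.2 +
      (M⁻¹ * N) i 2 * (z.1 * z.2) := by
    intro i
    rw [hP, Matrix.mulVec, dotProduct, Fin.sum_univ_three]
    rfl
  exact ⟨h' 0, h' 1, h' 2⟩

/-- Coefficient comparison for a product of two linear combinations of `x`, `y`, `xy` which is
again such a linear combination. -/
theorem coeff_relations_of_mul_eq {a b c a' b' c' a'' b'' c'' : ℂ}
    (h : ∀ z ∈ bidisk, (a * z.1 + b * z.2 + c * (z.1 * z.2)) *
      (a' * z.1 + b' * z.2 + c' * (z.1 * z.2)) = a'' * z.1 + b'' * z.2 + c'' * (z.1 * z.2)) :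
    a * a' = 0 ∧ b * b' = 0 ∧ a * c' + c * a' = 0 ∧ b * c' + c * b' = 0 := by
  have m : ∀ s t : ℂ, ‖s‖ < 1 → ‖t‖ < 1 → (s, t) ∈ bidisk := fun s t hs ht =>
    mem_bidisk.mpr ⟨hs, ht⟩
  have n0 : ‖(0 : ℂ)‖ < 1 := by simp
  have n1 : ‖(1 / 2 : ℂ)‖ < 1 := by norm_num
  have n2 : ‖(-1 / 2 : ℂ)‖ < 1 := by norm_num
  have e1 := h _ (m _ _ n1 n0)
  have e2 := h _ (m _ _ n2 n0)
  have e3 := h _ (m _ _ n0 n1)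
  have e4 := h _ (m _ _ n0 n2)
  have e5 := h _ (m _ _ n1 n1)
  have e6 := h _ (m _ _ n1 n2)
  have e7 := h _ (m _ _ n2 n1)
  have e8 := h _ (m _ _ n2 n2)
  dsimp only at e1 e2 e3 e4 e5 e6 e7 e8
  have r1 : a * a' = 0 := by linear_combination 2 * e1 + 2 * e2
  have r2 : b * b' = 0 := by linear_combination 2 * e3 + 2 * e4
  refine ⟨r1, r2, ?_, ?_⟩
  · linear_combination 2 * (e5 - e6 + e7 - e8) - 2 * (2 * e3 - 2 * e4)
  · linear_combination 2 * (e5 + e6 - e7 - e8) - 2 * (2 * e1 - 2 * e2)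

/-- The rotation case of the rigidity statement. -/
theorem eq_rotation_of_kernel_eq {p q : ℂ × ℂ → ℂ}
    (h : ∀ z ∈ bidisk, ∀ w ∈ bidisk, (1 - p z * conj (p w)) * (1 - q z * conj (q w)) =
      (1 - z.1 * conj w.1) * (1 - z.2 * conj w.2)) {a b c a' b' c' : ℂ}
    (hp : ∀ z ∈ bidisk, p z = a * z.1 + b * z.2 + c * (z.1 * z.2))
    (hq : ∀ z ∈ bidisk, q z = a' * z.1 + b' * z.2 + c' * (z.1 * z.2))
    (r1 : a * a' = 0) (r2 : b * b' = 0) (r3 : a * c' + c * a' = 0) (r4 : b * c' + c * b' = 0)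
    (ha : a ≠ 0) :
    ∃ θ₁ θ₂ : ℝ, ∀ z ∈ bidisk, p z = Complex.exp (Complex.I * θ₁) * z.1 ∧
      q z = Complex.exp (Complex.I * θ₂) * z.2 := by
  have m1 : ((1 / 2, 0) : ℂ × ℂ) ∈ bidisk := by simp [mem_bidisk]; norm_num
  have m2 : ((0, 1 / 2) : ℂ × ℂ) ∈ bidisk := by simp [mem_bidisk]; norm_num
  have ha' : a' = 0 := by simpa [ha] using r1
  have hc' : c' = 0 := by simpa [ha, ha'] using r3
  subst ha' hc'
  have k11 := h _ m1 _ m1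
  have k12 := h _ m1 _ m2
  have k22 := h _ m2 _ m2
  rw [hp _ m1, hq _ m1] at k11 k12
  rw [hp _ m2, hq _ m2] at k12 k22
  simp [map_ofNat] at k11 k12 k22
  have hb' : b' ≠ 0 := by
    rintro rfl
    rcases k12 with h0 | h0
    · exact ha h0
    · rw [h0] at k22
      norm_num [map_ofNat] at k22
  have hb : b = 0 := by simpa [hb'] using r2
  have hc : c = 0 := by simpa [hb', hb] using r4
  subst hb hc
  have unit : ∀ u : ℂ, u * conj u = 1 → ∃ θ : ℝ, u = Complex.exp (Complex.I * θ) := by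
    intro u hu
    rw [Complex.mul_conj'] at hu
    have hn : ‖u‖ = 1 := by
      have : ‖u‖ ^ 2 = 1 := by exact_mod_cast hu
      exact (pow_eq_one_iff_of_nonneg (norm_nonneg _) two_ne_zero).mp this
    obtain ⟨θ, hθ⟩ := (Complex.norm_eq_one_iff u).mp hn
    exact ⟨θ, by rw [← hθ, mul_comm]⟩
  obtain ⟨θ₁, h₁⟩ := unit a (by linear_combination 4 * k11)
  obtain ⟨θ₂, h₂⟩ := unit b' (by rw [map_zero] at k22; linear_combination -4 * k22)
  refine ⟨θ₁, θ₂, fun z hz => ?_⟩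
  rw [hp z hz, hq z hz, ← h₁, ← h₂]
  constructor <;> ring

theorem eq_rotation_or_swap_of_kernel_eq {p q : ℂ × ℂ → ℂ}
    (h : ∀ z ∈ bidisk, ∀ w ∈ bidisk, (1 - p z * conj (p w)) * (1 - q z * conj (q w)) =
      (1 - z.1 * conj w.1) * (1 - z.2 * conj w.2)) :
    ∃ θ₁ θ₂ : ℝ,
      (∀ z ∈ bidisk, p z = Complex.exp (Complex.I * θ₁) * z.1 ∧
        q z = Complex.exp (Complex.I * θ₂) * z.2) ∨
      (∀ z ∈ bidisk, p z = Complex.exp (Complex.I * θ₂) * z.2 ∧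
        q z = Complex.exp (Complex.I * θ₁) * z.1) := by
  obtain ⟨L, hL⟩ := exists_linear_of_kernel_eq h
  obtain ⟨r1, r2, r3, r4⟩ := coeff_relations_of_mul_eq (a := L 0 0) (b := L 0 1)
    (c := L 0 2) (a' := L 1 0) (b' := L 1 1) (c' := L 1 2)
    (a'' := L 2 0) (b'' := L 2 1) (c'' := L 2 2) fun z hz => by
    obtain ⟨e1, e2, e3⟩ := hL z hz
    rw [← e1, ← e2]
    exact e3
  by_cases ha : L 0 0 = 0
  · have ha' : L 1 0 ≠ 0 := by
      intro ha'
      have m1 : ((1 / 2, 0) : ℂ × ℂ) ∈ bidisk := by simp [mem_bidisk]; norm_num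
      have k := h _ m1 _ m1
      rw [(hL _ m1).1, (hL _ m1).2.1, ha, ha'] at k
      norm_num [map_ofNat] at k
    obtain ⟨θ₁, θ₂, hθ⟩ := eq_rotation_of_kernel_eq (p := q) (q := p)
      (fun z hz w hw => by rw [mul_comm, h z hz w hw])
      (fun z hz => (hL z hz).2.1) (fun z hz => (hL z hz).1)
      (by rw [mul_comm, r1]) (by rw [mul_comm, r2]) (by linear_combination r3)
      (by linear_combination r4) ha'
    exact ⟨θ₁, θ₂, .inr fun z hz => (hθ z hz).symm⟩
  · obtain ⟨θ₁, θ₂, hθ⟩ := eq_rotation_of_kernel_eq h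
      (fun z hz => (hL z hz).1) (fun z hz => (hL z hz).2.1) r1 r2 r3 r4 ha
    exact ⟨θ₁, θ₂, .inl hθ⟩

theorem mainTheorem3 (ψ : ℂ × ℂ → ℂ × ℂ)
    (hol : DifferentiableOn ℂ ψ bidisk) (maps : Set.MapsTo ψ bidisk bidisk)
    (hQ : ClassQ (fun z => (ψ z).1) (fun z => (ψ z).2) (fun z => (ψ z).1 * (ψ z).2))
    (h0 : ψ (0, 0) = (0, 0)) :
    ClassS (fun z => (ψ z).1) (fun z => (ψ z).2) (fun z => (ψ z).1 * (ψ z).2) ∧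
    (∀ z ∈ bidisk,
      0 ≤ ‖(ψ z).1‖ ^ 2 + ‖(ψ z).2‖ ^ 2 - ‖(ψ z).1 * (ψ z).2‖ ^ 2 ∧
      ‖(ψ z).1‖ ^ 2 + ‖(ψ z).2‖ ^ 2 - ‖(ψ z).1 * (ψ z).2‖ ^ 2 ≤
        ‖z.1‖ ^ 2 + ‖z.2‖ ^ 2 - ‖z.1 * z.2‖ ^ 2) ∧
    ((∃ V : Set (ℂ × ℂ), IsOpen V ∧ V.Nonempty ∧ V ⊆ bidisk ∧
        ∀ z ∈ V, ‖(ψ z).1‖ ^ 2 + ‖(ψ z).2‖ ^ 2 - ‖(ψ z).1 * (ψ z).2‖ ^ 2 =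
          ‖z.1‖ ^ 2 + ‖z.2‖ ^ 2 - ‖z.1 * z.2‖ ^ 2) →
      ∃ θ₁ θ₂ : ℝ,
        (∀ z ∈ bidisk,
          ψ z = (Complex.exp (Complex.I * θ₁) * z.1, Complex.exp (Complex.I * θ₂) * z.2)) ∨
        (∀ z ∈ bidisk,
          ψ z = (Complex.exp (Complex.I * θ₂) * z.2, Complex.exp (Complex.I * θ₁) * z.1))) := by
  obtain ⟨f₁, f₂, f₃, hf₁, hf₂, hf₃, hle⟩ := hQ
  have hmul : ∀ z, f₃ z = f₁ z * f₂ z := fun z => by rw [hf₁, hf₂, hf₃]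
  have hlt : ∀ z : bidisk, ‖(ψ z).1‖ < 1 ∧ ‖(ψ z).2‖ < 1 := fun z => mem_bidisk.mp (maps z.2)
  have hS := opLE_zero_defectOp_of_opLE_idOp hmul (fun z => by rw [hf₁]; exact (hlt z).1)
    (fun z => by rw [hf₂]; exact (hlt z).2) hle
  have hK := (opLE_defectOp_idOp_iff hmul).mp hle
  let K : bidisk → bidisk → ℂ := fun z w =>
    (1 - (ψ z).1 * conj (ψ w).1) * (1 - (ψ z).2 * conj (ψ w).2) /
      ((1 - z.1.1 * conj w.1.1) * (1 - z.1.2 * conj w.1.2))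
  replace hK : IsPSDKernel K := by
    convert hK using 3 with z w
    simp only [K]
    rw [hf₁, hf₁, hf₂, hf₂, ker_apply, mul_one_div]
    simp only [mul_comm, RCLike.star_def]
  have hden : ∀ z w : bidisk, (1 - z.1.1 * conj w.1.1) * (1 - z.1.2 * conj w.1.2) ≠ 0 :=
    fun z w => mul_ne_zero
      (one_sub_mul_conj_ne_zero (mem_bidisk.mp z.2).1 (mem_bidisk.mp w.2).1)
      (one_sub_mul_conj_ne_zero (mem_bidisk.mp z.2).2 (mem_bidisk.mp w.2).2)
  let o : bidisk := ⟨(0, 0), mem_bidisk.mpr (by simp)⟩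
  have ho₁ : ∀ z, K z o = 1 := fun z => by simp [K, o, h0]
  have ho₂ : ∀ z, K o z = 1 := fun z => by simp [K, o, h0]
  have hdiag : ∀ z : bidisk, K z z = (((1 - ‖(ψ z).1‖ ^ 2) * (1 - ‖(ψ z).2‖ ^ 2) /
      ((1 - ‖z.1.1‖ ^ 2) * (1 - ‖z.1.2‖ ^ 2)) : ℝ) : ℂ) := fun z => by
    simp only [K, Complex.mul_conj']
    push_cast
    rfl
  have hpos : ∀ z : bidisk, 0 < (1 - ‖z.1.1‖ ^ 2) * (1 - ‖z.1.2‖ ^ 2) := fun z => by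
    obtain ⟨h1, h2⟩ := mem_bidisk.mp z.2
    exact mul_pos (sub_pos.mpr (pow_lt_one₀ (norm_nonneg _) h1 two_ne_zero))
      (sub_pos.mpr (pow_lt_one₀ (norm_nonneg _) h2 two_ne_zero))
  refine ⟨⟨f₁, f₂, f₃, hf₁, hf₂, hf₃, hS, hle⟩, fun z hz => ⟨?_, ?_⟩, ?_⟩
  · have h1 := pow_le_one₀ (n := 2) (norm_nonneg _) (hlt ⟨z, hz⟩).1.le
    rw [norm_mul, mul_pow]
    have := mul_nonneg (sub_nonneg.mpr h1) (sq_nonneg ‖(ψ z).2‖)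
    nlinarith [sq_nonneg ‖(ψ z).1‖]
  · have h1 := hK.one_le_diag ho₁ ho₂ ⟨z, hz⟩
    rw [hdiag] at h1
    have h2 := (one_le_div (hpos ⟨z, hz⟩)).mp (by exact_mod_cast h1)
    dsimp only at h2
    rw [norm_mul, norm_mul, mul_pow, mul_pow]
    linarith
  · rintro ⟨V, hVo, hVn, hVs, hV⟩
    have hrow : ∀ z (hz : z ∈ V) (w : bidisk), K ⟨z, hVs hz⟩ w = 1 := fun z hz w => by
      refine hK.eq_one_of_diag_eq_one ho₁ ho₂ ?_ w
      rw [hdiag, Complex.ofReal_eq_one, div_eq_one_iff_eq (hpos _).ne']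
      have := hV z hz
      rw [norm_mul, norm_mul, mul_pow, mul_pow] at this
      dsimp only
      linarith
    have hker : ∀ z ∈ bidisk, ∀ w ∈ bidisk,
        (1 - (ψ z).1 * conj (ψ w).1) * (1 - (ψ z).2 * conj (ψ w).2) =
          (1 - z.1 * conj w.1) * (1 - z.2 * conj w.2) := by
      intro z hz w hw
      rw [← sub_eq_zero]
      refine eqOn_bidisk_of_eqOn_open (g := fun z =>
        (1 - (ψ z).1 * conj (ψ w).1) * (1 - (ψ z).2 * conj (ψ w).2) -
          (1 - z.1 * conj w.1) * (1 - z.2 * conj w.2)) ?_ hVo hVn hVs (fun z hz => ?_) z hz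
      · have := hol.fst
        have := hol.snd
        fun_prop
      · exact sub_eq_zero.mpr ((div_eq_one_iff_eq (hden ⟨z, hVs hz⟩ ⟨w, hw⟩)).mp
          (hrow z hz ⟨w, hw⟩))
    obtain ⟨θ₁, θ₂, hθ⟩ := eq_rotation_or_swap_of_kernel_eq hker
    exact ⟨θ₁, θ₂, hθ.imp (fun h z hz => Prod.ext (h z hz).1 (h z hz).2)
      (fun h z hz => Prod.ext (h z hz).1 (h z hz).2)⟩
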